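/- Let $m,c_1,\dots,c_m$ be positive integers and $C=\sum_{j=1}^m c_j$. For $K\in\mathbb N$ let $S_K=\sum_{k=1}^K\frac1k-\log(K+1)$, let $\gamma=\lim_{K\to\infty}S_K$ be Euler's constant, and read $0^0=1$. Then there is a constant $M=M(c_1,\dots,c_m)<C^{m-1}$, depending only on $c_1,\dots,c_m$, such that for all positive integers $r,b,n$ and all integers $a\ge0$ with $a-c_m\le b-C\le a$, $$\left|\gamma-\frac{\prod_{j=1}^m(c_jn)!}{(Cn)!\,(-r)^{Cn}}\sum_{k=0}^{Cn}(-1)^k\binom{Cn}{k}\prod_{j=1}^m\binom{rk+(a+c_1+\dots+c_j)n+j}{c_jn}\,S_{rk+bn+m}\right|$$ $$<M\left(\frac{b^{b/r}\,C^C\,(C+a-b)^{C+a-b}\,(c_m+b-a-C)^{c_m+b-a-C}}{c_m^{c_m}\,(b+Cr)^{C+b/r}}\right)^n.$$ -/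

import Mathlib

noncomputable section

/-- The total `C = c₁ + ⋯ + c_m` of a tuple of natural numbers. -/
def total {m : ℕ} (c : Fin m → ℕ) : ℕ := ∑ j, c j

/-- The partial total `c₁ + ⋯ + c_j` of a tuple, up to and including the entry at position `j`. -/
def partialTotal {m : ℕ} (c : Fin m → ℕ) (j : Fin m) : ℕ := ∑ i ∈ Finset.Iic j, c i

/-- The last entry `c_m` of a nonempty tuple. -/
def lastEntry {m : ℕ} (hm : 0 < m) (c : Fin m → ℕ) : ℕ := c ⟨m - 1, Nat.sub_lt hm Nat.one_pos⟩

/-- The multi-product linear form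
`∏ (c_j n)! / ((C n)! (-r)^(C n)) * ∑_{k=0}^{C n} (-1)^k binom(C n, k)
  * ∏_j binom(r k + (a + c₁ + ⋯ + c_j) n + j, c_j n) * S_{r k + b n + m}`,
where `S_K = 1 + 1/2 + ⋯ + 1/K - log (K + 1)` is `Real.eulerMascheroniSeq K`.
The entries of `c` are numbered from `0` here, so the `j` of the formula is `(j : ℕ) + 1`. -/
def linearForm {m : ℕ} (c : Fin m → ℕ) (r b n a : ℕ) : ℝ :=
  (∏ j, ((c j * n).factorial : ℝ)) /
      (((total c * n).factorial : ℝ) * (-(r : ℝ)) ^ (total c * n)) *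
    ∑ k ∈ Finset.range (total c * n + 1),
      (-1 : ℝ) ^ k * ((total c * n).choose k : ℝ) *
        (∏ j : Fin m,
          ((r * k + (a + partialTotal c j) * n + ((j : ℕ) + 1)).choose (c j * n) : ℝ)) *
        Real.eulerMascheroniSeq (r * k + b * n + m)

/-- The base of the geometric rate, with real parameters `C`, `d = c_m`, `r`, `b`, `a`:
`b^(b/r) C^C (C+a-b)^(C+a-b) (d+b-a-C)^(d+b-a-C) / (d^d (b+Cr)^(C+b/r))`.
All powers are real powers, for which `0 ^ 0 = 1`. -/
def rateBase (C d r b a : ℝ) : ℝ :=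
  (b ^ (b / r) * C ^ C * (C + a - b) ^ (C + a - b) * (d + b - a - C) ^ (d + b - a - C)) /
    (d ^ d * (b + C * r) ^ (C + b / r))

end

/-! Write `θ = x d/dx`, `T = C n`. Multiplied by the factorials, the product of binomials is a
product of `T` factors `r k + κ + 1`, a polynomial in `k` of degree `T`. Its `T`-th difference is
explicit (`alternating_sum_shiftProd`) and shows that the form has total weight one; so the error is
the same sum with `γ - S_K` in place of `S_K`.

Now `γ - S_K` is the integral over `t ∈ (0,1)` of the moments of `(1 - x^t)/(1 - x)`, and that
quotient is a positive mixture of the kernels `1/(x + u)`, `u > 0`. By `abs_sum_gamma_le` it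
suffices to bound the sum with `∫ x^K/(x + u)` in place of `γ - S_K`, uniformly in `u`.

For fixed `u` that sum is the integral of `x^q/(x + u)` against `∏(θ + κ + 1)(1 - x^r)^T`, with `q =
b n + m`. Integrating by parts moves the operators onto the kernel. The last block splits as `c_m =
p + e` with `e = C + a - b`, so that its `c_m n` steps each leave a single term and produce exactly
a multiple of `u^(pn) x^(q+en)/(x + u)^(c_m n+1)`. The other blocks cost only a product of integers
(`abs_pairing_le`), at most `C^(m-1) (C n)!` together with `(c_m n)!` (`mul_prod_blocks_le`).

What remains is the `n`-th power of a fixed function times `x^m/(x + u)`; maximising that function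
gives `r^C` times the rate. The leftover factor `γ - S_m < 2/3` makes the constant smaller than
`C^(m-1)`. -/

namespace EulerGamma

open intervalIntegral

/-! ### Shift operators and alternating sums as finite differences. -/

/-- The product `∏ (e + κ + 1)` over the entries `κ` of a list. -/
def shiftProd (l : List ℕ) (e : ℕ) : ℕ := (l.map fun κ => e + κ + 1).prod

/-- The polynomial `∏ (θ + κ + 1) (1 - x ^ r) ^ T`, where `θ = x d/dx`. -/
noncomputable def altSum (r T : ℕ) (l : List ℕ) (x : ℝ) : ℝ :=
  ∑ k ∈ Finset.range (T + 1),
    (-1 : ℝ) ^ k * (T.choose k : ℝ) * (shiftProd l (r * k) : ℝ) * x ^ (r * k)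

/-- The kernel `x ^ q / (x + u) ^ s`. -/
noncomputable def kern (u : ℝ) (q s : ℕ) (x : ℝ) : ℝ := x ^ q / (x + u) ^ s

/-- The integral of a kernel against `altSum`. -/
noncomputable def pairing (r T : ℕ) (u : ℝ) (l : List ℕ) (q s : ℕ) : ℝ :=
  ∫ x in (0 : ℝ)..1, kern u q s x * altSum r T l x

theorem shiftProd_cons (κ : ℕ) (l : List ℕ) (e : ℕ) :
    shiftProd (κ :: l) e = (e + κ + 1) * shiftProd l e := by
  simp [shiftProd]

theorem shiftProd_append (l l' : List ℕ) (e : ℕ) :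
    shiftProd (l ++ l') e = shiftProd l e * shiftProd l' e := by
  simp [shiftProd]

/-- The polynomial `∏ (r X + κ + 1)`. -/
noncomputable def shiftPoly (r : ℕ) (l : List ℕ) : Polynomial ℝ :=
  (l.map fun κ => Polynomial.C (r : ℝ) * Polynomial.X + Polynomial.C ((κ : ℝ) + 1)).prod

theorem eval_shiftPoly (r : ℕ) (l : List ℕ) (k : ℕ) :
    (shiftPoly r l).eval (k : ℝ) = (shiftProd l (r * k) : ℝ) := by
  induction l with
  | nil => simp [shiftPoly, shiftProd]
  | cons κ l ih =>
    have : shiftPoly r (κ :: l) =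
        (Polynomial.C (r : ℝ) * Polynomial.X + Polynomial.C ((κ : ℝ) + 1)) * shiftPoly r l := by
      simp [shiftPoly]
    rw [this, Polynomial.eval_mul, ih, shiftProd_cons]
    simp only [Polynomial.eval_add, Polynomial.eval_mul, Polynomial.eval_C, Polynomial.eval_X]
    push_cast
    ring

theorem natDegree_leadingCoeff_shiftPoly {r : ℕ} (hr : 0 < r) (l : List ℕ) :
    (shiftPoly r l).natDegree = l.length ∧ (shiftPoly r l).leadingCoeff = (r : ℝ) ^ l.length := by
  have hr' : (r : ℝ) ≠ 0 := by positivity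
  induction l with
  | nil => simp [shiftPoly]
  | cons κ l ih =>
    have : shiftPoly r (κ :: l) =
        (Polynomial.C (r : ℝ) * Polynomial.X + Polynomial.C ((κ : ℝ) + 1)) * shiftPoly r l := by
      simp [shiftPoly]
    have h0 : shiftPoly r l ≠ 0 := by
      intro h
      have := ih.2
      rw [h] at this
      simp at this
      exact absurd this.symm (by positivity)
    have h1 : Polynomial.C (r : ℝ) * Polynomial.X + Polynomial.C ((κ : ℝ) + 1) ≠ 0 := by
      intro h
      have := Polynomial.leadingCoeff_linear (b := (κ : ℝ) + 1) hr'
      rw [h] at this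
      simp at this
      exact hr' this.symm
    rw [this, Polynomial.natDegree_mul h1 h0, Polynomial.leadingCoeff_mul, ih.1, ih.2,
      Polynomial.natDegree_linear hr', Polynomial.leadingCoeff_linear hr']
    simp [pow_succ, add_comm, mul_comm]

theorem alternating_sum_eval (T : ℕ) (P : Polynomial ℝ) :
    ∑ k ∈ Finset.range (T + 1), (-1 : ℝ) ^ k * (T.choose k : ℝ) * P.eval (k : ℝ) =
      (-1) ^ T * (fwdDiff (1 : ℝ))^[T] P.eval 0 := by
  rw [fwdDiff_iter_eq_sum_shift, Finset.mul_sum]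
  refine Finset.sum_congr rfl fun k hk => ?_
  have hk : k ≤ T := Nat.lt_succ_iff.mp (Finset.mem_range.mp hk)
  obtain ⟨i, rfl⟩ := Nat.exists_eq_add_of_le hk
  have : ((-1 : ℝ) ^ (k + i)) * (-1) ^ i = (-1) ^ k := by
    rw [pow_add, mul_assoc, ← mul_pow]
    simp
  simp only [Nat.add_sub_cancel_left, zsmul_eq_mul]
  push_cast
  rw [← this]
  simp
  ring

/-- A `T`-th difference kills polynomials of degree below `T`. This removes the boundary term at `1`
in each integration by parts. -/
theorem altSum_one_eq_zero {r T : ℕ} (hr : 0 < r) {l : List ℕ} (hl : l.length < T) :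
    altSum r T l 1 = 0 := by
  have h := alternating_sum_eval T (shiftPoly r l)
  rw [Polynomial.fwdDiff_iter_eq_zero_of_degree_lt
    (by rwa [(natDegree_leadingCoeff_shiftPoly hr l).1])] at h
  simpa [altSum, eval_shiftPoly] using h

theorem alternating_sum_shiftProd {r T : ℕ} (hr : 0 < r) {l : List ℕ} (hl : l.length = T) :
    ∑ k ∈ Finset.range (T + 1), (-1 : ℝ) ^ k * (T.choose k : ℝ) * (shiftProd l (r * k) : ℝ) =
      (-(r : ℝ)) ^ T * (T.factorial : ℝ) := by
  have h := alternating_sum_eval T (shiftPoly r l)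
  obtain ⟨h1, h2⟩ := natDegree_leadingCoeff_shiftPoly hr l
  have h3 := Polynomial.fwdDiff_iter_degree_eq_factorial (shiftPoly r l)
  rw [h1, h2, hl] at h3
  rw [h3] at h
  simp only [eval_shiftPoly] at h
  rw [h, neg_pow (r : ℝ)]
  simp
  ring

theorem altSum_nil (r T : ℕ) (x : ℝ) : altSum r T [] x = (1 - x ^ r) ^ T := by
  rw [sub_eq_neg_add, add_pow]
  simp only [altSum, shiftProd, List.map_nil, List.prod_nil, Nat.cast_one, one_pow, mul_one]
  refine Finset.sum_congr rfl fun k _ => ?_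
  rw [neg_pow (x ^ r), ← pow_mul]
  ring

theorem continuous_altSum (r T : ℕ) (l : List ℕ) : Continuous (altSum r T l) := by
  unfold altSum
  fun_prop

/-! ### Integration by parts against the kernels. -/

theorem continuousOn_kern {u : ℝ} (hu : 0 < u) (q s : ℕ) :
    ContinuousOn (kern u q s) (Set.Icc 0 1) := by
  unfold kern
  refine ContinuousOn.div (by fun_prop) (by fun_prop) fun x hx => ?_
  have := hx.1
  positivity

theorem intervalIntegrable_kern_mul {u : ℝ} (hu : 0 < u) (q s : ℕ) {f : ℝ → ℝ}
    (hf : Continuous f) :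
    IntervalIntegrable (fun x => kern u q s x * f x) MeasureTheory.volume 0 1 := by
  refine ContinuousOn.intervalIntegrable ?_
  rw [Set.uIcc_of_le zero_le_one]
  exact (continuousOn_kern hu q s).mul hf.continuousOn

theorem hasDerivAt_mul_altSum (r T : ℕ) (l : List ℕ) (κ : ℕ) (x : ℝ) :
    ∃ p', HasDerivAt (altSum r T l) p' x ∧
      x * p' = altSum r T (κ :: l) x - (κ + 1) * altSum r T l x := by
  refine ⟨∑ k ∈ Finset.range (T + 1), (-1 : ℝ) ^ k * (T.choose k : ℝ) *
    (shiftProd l (r * k) : ℝ) * (((r * k : ℕ) : ℝ) * x ^ (r * k - 1)), ?_, ?_⟩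
  · unfold altSum
    refine HasDerivAt.fun_sum fun k _ => ?_
    exact (hasDerivAt_pow (r * k) x).const_mul _
  · unfold altSum
    rw [Finset.mul_sum, Finset.mul_sum, ← Finset.sum_sub_distrib]
    refine Finset.sum_congr rfl fun k _ => ?_
    rw [shiftProd_cons]
    rcases Nat.eq_zero_or_pos (r * k) with h | h
    · rw [h]; simp; ring
    · have : x ^ (r * k) = x * x ^ (r * k - 1) := by rw [← pow_succ', Nat.sub_add_cancel h]
      rw [this]
      push_cast
      ring

theorem hasDerivAt_kern {u : ℝ} (hu : 0 < u) (q s : ℕ) {x : ℝ} (hx : 0 ≤ x) :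
    ∃ g', HasDerivAt (kern u q s) g' x ∧
      x * g' = q * kern u q s x - s * kern u (q + 1) (s + 1) x := by
  have hxu : x + u ≠ 0 := by positivity
  refine ⟨_, (hasDerivAt_pow q x).div (((hasDerivAt_id x).add_const u).pow s)
    (pow_ne_zero _ hxu), ?_⟩
  unfold kern
  have h1 : ∀ q : ℕ, x * ((q : ℝ) * x ^ (q - 1)) = q * x ^ q := by
    intro q
    cases q with
    | zero => simp
    | succ q => simp [pow_succ]; ring
  have h2 : (x + u) * ((s : ℝ) * (x + u) ^ (s - 1)) = s * (x + u) ^ s := by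
    cases s with
    | zero => simp
    | succ s => simp [pow_succ]; ring
  have h3 : (s : ℝ) * (x + u) ^ (s - 1) = s * (x + u) ^ s / (x + u) := by
    rw [← h2]; field_simp
  simp only [id, mul_one]
  rw [mul_div_assoc', mul_sub, ← mul_assoc x, h1, h3]
  field_simp
  ring

theorem kern_succ_succ {u : ℝ} (hu : 0 < u) (q s : ℕ) {x : ℝ} (hx : 0 ≤ x) :
    kern u (q + 1) (s + 1) x = kern u q s x - u * kern u q (s + 1) x := by
  have hxu : x + u ≠ 0 := by positivity
  unfold kern
  field_simp
  ring

/-- The adjoint of `θ + κ + 1` on the unit interval is `κ - θ`, up to boundary terms, and `θ` sends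
the kernel `(q, s)` to `q (q, s) - s (q + 1, s + 1)`. -/
theorem pairing_cons {r T : ℕ} (hr : 0 < r) {u : ℝ} (hu : 0 < u) (κ : ℕ) {l : List ℕ}
    (hl : l.length < T) (q s : ℕ) :
    pairing r T u (κ :: l) q s =
      ((κ : ℝ) - q) * pairing r T u l q s + s * pairing r T u l (q + 1) (s + 1) := by
  have hcont : ∀ l q s, IntervalIntegrable (fun x => kern u q s x * altSum r T l x)
      MeasureTheory.volume 0 1 :=
    fun l q s => intervalIntegrable_kern_mul hu q s (continuous_altSum r T l)
  have key : ∫ x in (0 : ℝ)..1, (kern u q s x * altSum r T (κ :: l) x -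
      (((κ : ℝ) - q) * (kern u q s x * altSum r T l x) +
        s * (kern u (q + 1) (s + 1) x * altSum r T l x))) = 0 := by
    -- This primitive vanishes at `0` through the factor `x`, and at `1` because fewer than `T`
    -- operators have been applied.
    rw [integral_eq_sub_of_hasDerivAt (f := fun x => x * (kern u q s x * altSum r T l x))]
    · simp [altSum_one_eq_zero hr hl]
    · intro x hx
      rw [Set.uIcc_of_le zero_le_one] at hx
      obtain ⟨p', hp, hp'⟩ := hasDerivAt_mul_altSum r T l κ x
      obtain ⟨g', hg, hg'⟩ := hasDerivAt_kern hu q s hx.1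
      refine HasDerivAt.congr_deriv ((hasDerivAt_id x).mul (hg.mul hp)) ?_
      simp only [id]
      linear_combination kern u q s x * hp' + altSum r T l x * hg'
    · exact (hcont _ _ _).sub (((hcont _ _ _).const_mul _).add ((hcont _ _ _).const_mul _))
  rw [integral_sub (hcont _ _ _) (((hcont _ _ _).const_mul _).add ((hcont _ _ _).const_mul _)),
    integral_add ((hcont _ _ _).const_mul _) ((hcont _ _ _).const_mul _),
    integral_const_mul, integral_const_mul] at key
  unfold pairing
  linarith

theorem pairing_succ_succ {r T : ℕ} {u : ℝ} (hu : 0 < u) (l : List ℕ) (q s : ℕ) :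
    pairing r T u l (q + 1) (s + 1) = pairing r T u l q s - u * pairing r T u l q (s + 1) := by
  have hcont : ∀ q s, IntervalIntegrable (fun x => kern u q s x * altSum r T l x)
      MeasureTheory.volume 0 1 :=
    fun q s => intervalIntegrable_kern_mul hu q s (continuous_altSum r T l)
  unfold pairing
  rw [← integral_const_mul, ← integral_sub (hcont _ _) ((hcont _ _).const_mul _)]
  refine integral_congr fun x hx => ?_
  rw [Set.uIcc_of_le zero_le_one] at hx
  simp only [kern_succ_succ hu q s hx.1]
  ring

/-- In this form both coefficients in the bracket are nonnegative when `κ ≤ q - s`, and the first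
vanishes when `κ = q - s`; in `pairing_cons` it vanishes when `κ = q`. -/
theorem pairing_cons' {r T : ℕ} (hr : 0 < r) {u : ℝ} (hu : 0 < u) (κ : ℕ) {l : List ℕ}
    (hl : l.length < T) (q s : ℕ) :
    pairing r T u (κ :: l) q s =
      -(((q : ℝ) - s - κ) * pairing r T u l q s + s * u * pairing r T u l q (s + 1)) := by
  rw [pairing_cons hr hu κ hl, pairing_succ_succ hu]
  ring

theorem pairing_nil_nonneg (r T : ℕ) {u : ℝ} (hu : 0 < u) (q s : ℕ) :
    0 ≤ pairing r T u [] q s := by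
  refine integral_nonneg zero_le_one fun x hx => ?_
  have h0 := hx.1
  have : 0 ≤ 1 - x ^ r := sub_nonneg.mpr (pow_le_one₀ hx.1 hx.2)
  rw [altSum_nil]
  unfold kern
  positivity

theorem mul_pairing_nil_succ_le (r T : ℕ) {u : ℝ} (hu : 0 < u) (q s : ℕ) :
    u * pairing r T u [] q (s + 1) ≤ pairing r T u [] q s := by
  have h := pairing_succ_succ (r := r) (T := T) hu [] q s
  have := pairing_nil_nonneg r T hu (q + 1) (s + 1)
  linarith

/-! ### Estimating a general list of shifts, and evaluating the special block. -/

/-- The `k`-th entry of the list (counted from zero) is at most `q - s - k`. -/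
def Admissible (q : ℕ) : ℕ → List ℕ → Prop
  | _, [] => True
  | s, κ :: l => s + κ ≤ q ∧ Admissible q (s + 1) l

theorem Admissible.mono {q : ℕ} {l : List ℕ} : ∀ {s s' : ℕ}, s ≤ s' → Admissible q s' l →
    Admissible q s l := by
  induction l with
  | nil => intros; trivial
  | cons κ l ih =>
    intro s s' h ha
    exact ⟨(Nat.add_le_add_right h κ).trans ha.1, ih (Nat.succ_le_succ h) ha.2⟩

/-- Each shift contributes `(q - s - κ) + s`: the two coefficients of `pairing_cons'`, once the
extra factor `u/(x + u) ≤ 1` is dropped. The sum `q - κ` no longer depends on `s`, so the factors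
multiply. -/
theorem abs_pairing_le {r T : ℕ} (hr : 0 < r) {u : ℝ} (hu : 0 < u) (q : ℕ) (l : List ℕ)
    (hl : l.length ≤ T) : ∀ s, Admissible q s l →
    |pairing r T u l q s| ≤ ((l.map fun κ => q - κ).prod : ℕ) * pairing r T u [] q s := by
  induction l with
  | nil =>
    intro s _
    simp [abs_of_nonneg (pairing_nil_nonneg r T hu q s)]
  | cons κ l ih =>
    intro s ⟨h1, h2⟩
    have hl' : l.length < T := hl
    have i1 := ih hl'.le s (h2.mono (Nat.le_succ s))
    have i2 := ih hl'.le (s + 1) h2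
    have i3 := mul_pairing_nil_succ_le r T hu q s
    have hz : (0 : ℝ) ≤ (q : ℝ) - s - κ := by
      have : ((s + κ : ℕ) : ℝ) ≤ q := by exact_mod_cast h1
      push_cast at this
      linarith
    rw [pairing_cons' hr hu κ hl', abs_neg, List.map_cons, List.prod_cons, Nat.cast_mul,
      Nat.cast_sub (by omega)]
    generalize (((l.map fun κ => q - κ).prod : ℕ) : ℝ) = c, Nat.cast_nonneg (α := ℝ)
      (l.map fun κ => q - κ).prod = hc at *
    calc |((q : ℝ) - s - κ) * pairing r T u l q s + s * u * pairing r T u l q (s + 1)|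
        ≤ ((q : ℝ) - s - κ) * |pairing r T u l q s| + s * u * |pairing r T u l q (s + 1)| := by
          refine (abs_add_le _ _).trans_eq ?_
          rw [abs_mul, abs_mul, abs_of_nonneg hz, abs_of_nonneg (by positivity : 0 ≤ s * u)]
      _ ≤ ((q : ℝ) - s - κ) * (c * pairing r T u [] q s) +
          s * u * (c * pairing r T u [] q (s + 1)) := by gcongr
      _ = ((q : ℝ) - s - κ) * c * pairing r T u [] q s +
          s * c * (u * pairing r T u [] q (s + 1)) := by ring
      _ ≤ ((q : ℝ) - s - κ) * c * pairing r T u [] q s + s * c * pairing r T u [] q s := by gcongr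
      _ = ((q : ℝ) - κ) * c * pairing r T u [] q s := by ring

/-- Every shift equals `q` minus the current exponent `s`, so only the second term of
`pairing_cons'` survives, and `s` rises by one. -/
theorem pairing_descending {r T : ℕ} (hr : 0 < r) {u : ℝ} (hu : 0 < u) (q : ℕ) (l : List ℕ)
    (p : ℕ) : ∀ s, p + l.length ≤ T → s + p ≤ q + 1 →
    pairing r T u ((List.range p).map (fun i => q - (s + i)) ++ l) q s =
      (-u) ^ p * (s.ascFactorial p : ℝ) * pairing r T u l q (s + p) := by
  induction p with
  | zero => intros; simp
  | succ p ih =>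
    intro s hT hs
    have h := ih (s + 1) (by omega) (by omega)
    have h1 : (fun i => q - (s + i)) ∘ Nat.succ = fun i => q - (s + 1 + i) := by
      funext i
      simp only [Function.comp]
      omega
    have h2 : s.ascFactorial (p + 1) = s * (s + 1).ascFactorial p := by
      rw [← Nat.succ_eq_add_one s, Nat.succ_ascFactorial, Nat.ascFactorial_succ]
    have h3 : ((q - (s + 0) : ℕ) : ℝ) = q - s := by
      rw [add_zero, Nat.cast_sub (by omega)]
    rw [List.range_succ_eq_map, List.map_cons, List.map_map, List.cons_append,
      pairing_cons' hr hu _ (by simp; omega), h1, h, h2, h3, add_right_comm s 1 p, ← add_assoc]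
    push_cast
    ring

/-- Every shift equals the current `q`, so only the second term of `pairing_cons` survives, raising
both exponents. -/
theorem pairing_ascending {r T : ℕ} (hr : 0 < r) {u : ℝ} (hu : 0 < u) (l : List ℕ)
    (p : ℕ) : ∀ q s, p + l.length ≤ T →
    pairing r T u ((List.range p).map (fun i => q + i) ++ l) q s =
      (s.ascFactorial p : ℝ) * pairing r T u l (q + p) (s + p) := by
  induction p with
  | zero => intros; simp
  | succ p ih =>
    intro q s hT
    have h := ih (q + 1) (s + 1) (by omega)
    have h1 : (fun i => q + i) ∘ Nat.succ = fun i => q + 1 + i := by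
      funext i
      simp only [Function.comp]
      omega
    have h2 : s.ascFactorial (p + 1) = s * (s + 1).ascFactorial p := by
      rw [← Nat.succ_eq_add_one s, Nat.succ_ascFactorial, Nat.ascFactorial_succ]
    rw [List.range_succ_eq_map, List.map_cons, List.map_map, List.cons_append,
      pairing_cons hr hu _ (by simp; omega), h1, h, h2, add_right_comm s 1 p,
      add_right_comm q 1 p, ← add_assoc, ← add_assoc]
    push_cast
    ring

/-- The list of shifts belonging to a block with `d = p + e` derivatives, followed by `l`. -/
def fullList (q p e : ℕ) (l : List ℕ) : List ℕ :=
  (List.range p).map (fun i => q - (1 + i)) ++ ((List.range e).map (fun i => q + i) ++ l)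

theorem length_fullList (q p e : ℕ) (l : List ℕ) :
    (fullList q p e l).length = p + e + l.length := by
  simp [fullList, add_assoc]

/-- The first `p` factors run down from `k + q` and the next `e` run up from `k + q + 1`, so they
fill one interval of consecutive integers. -/
theorem shiftProd_fullList {q p : ℕ} (e : ℕ) (l : List ℕ) (hp : p ≤ q) (k : ℕ) :
    shiftProd (fullList q p e l) k = (k + q + e).descFactorial (p + e) * shiftProd l k := by
  have h1 : ∀ p, p ≤ q → shiftProd ((List.range p).map (fun i => q - (1 + i))) k =
      (k + q).descFactorial p := by
    intro p
    induction p with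
    | zero => intro; simp [shiftProd]
    | succ p ih =>
      intro hp
      rw [List.range_succ, List.map_append, shiftProd_append, ih (by omega),
        Nat.descFactorial_succ, mul_comm]
      simp only [shiftProd, List.map_cons, List.map_nil, List.prod_cons, List.prod_nil, mul_one]
      congr 1
      omega
  have h2 : ∀ e, shiftProd ((List.range e).map (fun i => q + i)) k =
      (k + q + 1).ascFactorial e := by
    intro e
    induction e with
    | zero => simp [shiftProd]
    | succ e ih =>
      rw [List.range_succ, List.map_append, shiftProd_append, ih, Nat.ascFactorial_succ, mul_comm]
      simp only [shiftProd, List.map_cons, List.map_nil, List.prod_cons, List.prod_nil, mul_one]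
      congr 1
      omega
  rw [fullList, shiftProd_append, shiftProd_append, h1 p hp, h2, ← mul_assoc,
    ← Nat.add_descFactorial_eq_ascFactorial]
  congr 1
  have := Nat.descFactorial_mul_descFactorial (n := k + q + e) (k := e) (m := p + e) (by omega)
  rw [← this]
  simp

theorem abs_pairing_fullList_le {r T : ℕ} (hr : 0 < r) {u : ℝ} (hu : 0 < u) {q p e : ℕ}
    {l : List ℕ} (hl : p + e + l.length ≤ T) (hp : p ≤ q)
    (hadm : Admissible (q + e) (p + e + 1) l) :
    |pairing r T u (fullList q p e l) q 1| ≤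
      u ^ p * ((p + e).factorial * (l.map fun κ => q + e - κ).prod : ℕ) *
        pairing r T u [] (q + e) (p + e + 1) := by
  have h := abs_pairing_le hr hu (q + e) l (by omega : l.length ≤ T) _ hadm
  have h3 : Nat.ascFactorial 1 p * (1 + p).ascFactorial e = (p + e).factorial := by
    rw [Nat.ascFactorial_mul_ascFactorial, Nat.one_ascFactorial]
  rw [fullList, pairing_descending hr hu q _ p 1 (by simpa using by omega) (by omega),
    pairing_ascending hr hu l e q (1 + p) (by omega), ← h3, ← mul_assoc, abs_mul,
    show 1 + p + e = p + e + 1 by ring, abs_mul, abs_mul, abs_pow, abs_neg, abs_of_pos hu]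
  rw [Nat.abs_cast, Nat.abs_cast]
  push_cast at h ⊢
  calc _ ≤ u ^ p * (Nat.ascFactorial 1 p : ℝ) * ((1 + p).ascFactorial e : ℝ) *
        (_ * pairing r T u [] (q + e) (p + e + 1)) := by gcongr
    _ = _ := by ring

theorem pairing_eq_sum {r T : ℕ} {u : ℝ} (hu : 0 < u) (l : List ℕ) (q : ℕ) :
    pairing r T u l q 1 = ∑ k ∈ Finset.range (T + 1),
      (-1 : ℝ) ^ k * (T.choose k : ℝ) * (shiftProd l (r * k) : ℝ) *
        ∫ x in (0 : ℝ)..1, x ^ (r * k + q) / (x + u) := by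
  unfold pairing altSum
  simp only [Finset.mul_sum]
  rw [integral_finsetSum]
  · refine Finset.sum_congr rfl fun k _ => ?_
    rw [← integral_const_mul]
    refine integral_congr fun x _ => ?_
    simp only [kern, pow_add, pow_one]
    ring
  · intro k _
    exact intervalIntegrable_kern_mul hu q 1 (by fun_prop)

end EulerGamma

namespace EulerGamma

/-! ### The remaining blocks and their factorial bound. -/

/-- The shifts of the blocks `0, …, M - 1`, the last block first. -/
def blocks (a : ℕ) (c : ℕ → ℕ) (n : ℕ) : ℕ → List ℕ
  | 0 => []
  | M + 1 => (List.range (c M * n)).map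
      (fun i => (a + ∑ j ∈ Finset.range (M + 1), c j) * n + M - i) ++ blocks a c n M

theorem length_blocks (a : ℕ) (c : ℕ → ℕ) (n M : ℕ) :
    (blocks a c n M).length = (∑ j ∈ Finset.range M, c j) * n := by
  induction M with
  | zero => simp [blocks]
  | succ M ih => simp [blocks, ih, Finset.sum_range_succ]; ring

theorem shiftProd_descending {B N : ℕ} (k : ℕ) (h : N ≤ B + 1) :
    shiftProd ((List.range N).map fun i => B - i) k = (k + B + 1).descFactorial N := by
  induction N with
  | zero => simp [shiftProd]
  | succ N ih =>
    rw [List.range_succ, List.map_append, shiftProd_append, ih (by omega),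
      Nat.descFactorial_succ, mul_comm]
    simp only [shiftProd, List.map_cons, List.map_nil, List.prod_cons, List.prod_nil, mul_one]
    congr 1
    omega

theorem shiftProd_blocks (a : ℕ) (c : ℕ → ℕ) (n M k : ℕ) :
    shiftProd (blocks a c n M) k = ∏ j ∈ Finset.range M,
      (k + (a + ∑ i ∈ Finset.range (j + 1), c i) * n + (j + 1)).descFactorial (c j * n) := by
  induction M with
  | zero => simp [blocks, shiftProd]
  | succ M ih =>
    have hle : c M * n ≤ (a + ∑ j ∈ Finset.range (M + 1), c j) * n := by
      refine Nat.mul_le_mul_right _ ?_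
      rw [Finset.sum_range_succ]
      omega
    rw [blocks, shiftProd_append, ih, Finset.prod_range_succ, mul_comm,
      shiftProd_descending k (by omega), add_assoc k, add_assoc k, add_assoc _ M 1]

/-- Along a descending run `s + κ` stays constant, so only its first entry has to be checked. -/
theorem admissible_descending_append (q B : ℕ) (l : List ℕ) (N : ℕ) :
    ∀ s C, C + B = q → s ≤ C → N ≤ B + 1 → Admissible q (s + N) l →
      Admissible q s ((List.range N).map (fun i => B - i) ++ l) := by
  induction N generalizing B with
  | zero => intro s C _ _ _ h; simpa using h
  | succ N ih =>
    intro s C hq hs hN h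
    rw [List.range_succ_eq_map, List.map_cons, List.map_map, List.cons_append]
    refine ⟨by omega, ?_⟩
    rcases Nat.eq_zero_or_pos N with rfl | hpos
    · simpa using h
    have h1 : (fun i => B - i) ∘ Nat.succ = fun i => B - 1 - i := by
      funext i
      simp only [Function.comp]
      omega
    rw [h1]
    exact ih (B - 1) (s + 1) (C + 1) (by omega) (by omega) (by omega)
      (by rwa [add_right_comm, add_assoc])

theorem admissible_blocks (q a : ℕ) (c : ℕ → ℕ) (n M : ℕ) : ∀ s,
    s + (a + ∑ j ∈ Finset.range M, c j) * n + M ≤ q + 1 → Admissible q s (blocks a c n M) := by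
  induction M with
  | zero => intros; trivial
  | succ M ih =>
    intro s hs
    have hle : c M * n ≤ (a + ∑ j ∈ Finset.range (M + 1), c j) * n := by
      refine Nat.mul_le_mul_right _ ?_
      rw [Finset.sum_range_succ]
      omega
    refine admissible_descending_append q _ _ _ s
      (q - ((a + ∑ j ∈ Finset.range (M + 1), c j) * n + M)) (by omega) (by omega) (by omega) ?_
    apply ih
    have : (a + ∑ j ∈ Finset.range (M + 1), c j) * n =
        (a + ∑ j ∈ Finset.range M, c j) * n + c M * n := by
      rw [Finset.sum_range_succ]; ring
    omega

theorem prod_sub_descending {B q N : ℕ} (h : N ≤ B + 1) (hq : B ≤ q) :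
    (((List.range N).map fun i => B - i).map fun κ => q - κ).prod =
      (q - B).ascFactorial N := by
  induction N with
  | zero => simp
  | succ N ih =>
    rw [List.range_succ, List.map_append, List.map_append, List.prod_append, ih (by omega),
      Nat.ascFactorial_succ, mul_comm]
    simp only [List.map_cons, List.map_nil, List.prod_cons, List.prod_nil, mul_one]
    congr 1
    omega

/-- Raising `t` by one multiplies the rising factorial by `1 + c n/(Y n + t + 1)`, which is at most
`(Y + c)/Y`. -/
theorem ascFactorial_mul_pow_le (Y c n t : ℕ) :
    (Y * n + t + 1).ascFactorial (c * n) * Y ^ t ≤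
      (Y * n + 1).ascFactorial (c * n) * (Y + c) ^ t := by
  induction t with
  | zero => simp
  | succ t ih =>
    have h1 := Nat.succ_ascFactorial (Y * n + t + 1) (c * n)
    rw [Nat.succ_eq_add_one] at h1
    have h2 : (Y * n + t + 1 + c * n) * Y ≤ (Y + c) * (Y * n + t + 1) := by nlinarith
    refine Nat.le_of_mul_le_mul_left (c := Y * n + t + 1) ?_ (by omega)
    calc (Y * n + t + 1) * ((Y * n + (t + 1) + 1).ascFactorial (c * n) * Y ^ (t + 1))
        = ((Y * n + t + 1) * (Y * n + t + 1 + 1).ascFactorial (c * n)) * Y ^ (t + 1) := by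
          rw [← add_assoc (Y * n) t 1]; ring
      _ = ((Y * n + t + 1 + c * n) * Y) * ((Y * n + t + 1).ascFactorial (c * n) * Y ^ t) := by
          rw [h1]; ring
      _ ≤ ((Y + c) * (Y * n + t + 1)) * ((Y * n + 1).ascFactorial (c * n) * (Y + c) ^ t) :=
          Nat.mul_le_mul h2 ih
      _ = _ := by ring

/-- Here `Y` is the sum of the `c_j` already absorbed, `K` the product so far and `t` the
accumulated offset. Absorbing a block extends the factorial and raises the power of `Y` by one. -/
theorem mul_prod_blocks_le (a : ℕ) (c : ℕ → ℕ) (n M : ℕ) : ∀ Y t K : ℕ, 0 < Y →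
    K ≤ (Y * n).factorial * Y ^ t →
    K * ((blocks a c n M).map fun κ =>
        (a + (∑ j ∈ Finset.range M, c j) + Y) * n + M + t + 1 - κ).prod ≤
      ((Y + ∑ j ∈ Finset.range M, c j) * n).factorial *
        (Y + ∑ j ∈ Finset.range M, c j) ^ (t + M) := by
  induction M with
  | zero => intro Y t K _ hK; simpa [blocks] using hK
  | succ M ih =>
    intro Y t K hY hK
    have hle : c M * n ≤ (a + ∑ j ∈ Finset.range (M + 1), c j) * n := by
      refine Nat.mul_le_mul_right _ ?_
      rw [Finset.sum_range_succ]
      omega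
    have hq : (a + (∑ j ∈ Finset.range (M + 1), c j) + Y) * n =
      (a + ∑ j ∈ Finset.range (M + 1), c j) * n + Y * n := by ring
    have hB : (a + (∑ j ∈ Finset.range (M + 1), c j) + Y) * n + (M + 1) + t + 1 -
        ((a + ∑ j ∈ Finset.range (M + 1), c j) * n + M) = Y * n + (t + 1) + 1 := by omega
    rw [blocks, List.map_append, List.prod_append,
      prod_sub_descending (by omega) (by omega), hB, ← mul_assoc]
    have hstep : K * (Y * n + (t + 1) + 1).ascFactorial (c M * n) ≤
        ((Y + c M) * n).factorial * (Y + c M) ^ (t + 1) := by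
      calc K * (Y * n + (t + 1) + 1).ascFactorial (c M * n)
          ≤ ((Y * n).factorial * Y ^ t) * (Y * n + (t + 1) + 1).ascFactorial (c M * n) :=
            Nat.mul_le_mul_right _ hK
        _ ≤ ((Y * n).factorial * Y ^ (t + 1)) *
            (Y * n + (t + 1) + 1).ascFactorial (c M * n) := by
            have : Y ^ t ≤ Y ^ (t + 1) := Nat.pow_le_pow_right hY (Nat.le_succ t)
            gcongr
        _ = (Y * n).factorial *
            ((Y * n + (t + 1) + 1).ascFactorial (c M * n) * Y ^ (t + 1)) := by ring
        _ ≤ (Y * n).factorial *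
            ((Y * n + 1).ascFactorial (c M * n) * (Y + c M) ^ (t + 1)) := by
            exact Nat.mul_le_mul_left _ (ascFactorial_mul_pow_le Y (c M) n (t + 1))
        _ = _ := by rw [← mul_assoc, Nat.factorial_mul_ascFactorial, add_mul]
    have h := ih (Y + c M) (t + 1) _ (by omega) hstep
    have e1 : (fun κ => (a + (∑ j ∈ Finset.range (M + 1), c j) + Y) * n + (M + 1) + t + 1 - κ) =
        fun κ => (a + (∑ j ∈ Finset.range M, c j) + (Y + c M)) * n + M + (t + 1) + 1 - κ := by
      funext κ
      rw [Finset.sum_range_succ]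
      congr 1
      ring
    have e2 : Y + ∑ j ∈ Finset.range (M + 1), c j = Y + c M + ∑ j ∈ Finset.range M, c j := by
      rw [Finset.sum_range_succ]
      ring
    rwa [e1, e2, show t + (M + 1) = t + 1 + M by ring]

end EulerGamma

namespace EulerGamma

open MeasureTheory Set intervalIntegral

/-! ### Representing `γ - S_K` by Cauchy kernels with positive weight. -/

theorem integrableOn_rpow_div_one_add {t : ℝ} (h0 : 0 < t) (h1 : t < 1) :
    IntegrableOn (fun u : ℝ => u ^ (t - 1) / (1 + u)) (Ioi 0) := by
  rw [← Ioc_union_Ioi_eq_Ioi zero_le_one, integrableOn_union]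
  have hm : ∀ s : Set ℝ, AEStronglyMeasurable (fun u : ℝ => u ^ (t - 1) / (1 + u))
      (volume.restrict s) := fun s => (by fun_prop : Measurable _).aestronglyMeasurable
  constructor
  · have h : IntegrableOn (fun u : ℝ => u ^ (t - 1)) (Ioc 0 1) :=
      (intervalIntegrable_iff_integrableOn_Ioc_of_le zero_le_one).mp
        (intervalIntegrable_rpow' (by linarith))
    refine h.mono' (hm _) ?_
    filter_upwards [ae_restrict_mem measurableSet_Ioc] with u hu
    have := Real.rpow_nonneg hu.1.le (t - 1)
    have hu0 := hu.1
    rw [Real.norm_of_nonneg (by positivity)]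
    exact div_le_self this (by linarith)
  · refine (integrableOn_Ioi_rpow_of_lt (a := t - 2) (by linarith) one_pos).mono' (hm _) ?_
    filter_upwards [ae_restrict_mem measurableSet_Ioi] with u hu
    have hu0 : 0 < u := one_pos.trans hu
    have := Real.rpow_nonneg hu0.le (t - 1)
    rw [Real.norm_of_nonneg (by positivity), show t - 2 = t - 1 - 1 by ring,
      Real.rpow_sub_one hu0.ne' (t - 1)]
    gcongr
    linarith

/-- The weight of the representation of `(1 - x ^ t) / (1 - x)` as a Stieltjes transform. -/
noncomputable def stieltjesWeight (t u : ℝ) : ℝ := u ^ t / (1 + u)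

/-- The normalisation of `stieltjesWeight`. -/
noncomputable def stieltjesConst (t : ℝ) : ℝ := ∫ u in Ioi (0 : ℝ), u ^ (t - 1) / (1 + u)

theorem stieltjesConst_pos {t : ℝ} (h0 : 0 < t) (h1 : t < 1) : 0 < stieltjesConst t := by
  refine (setIntegral_pos_iff_support_of_nonneg_ae ?_
    (integrableOn_rpow_div_one_add h0 h1)).mpr ?_
  · filter_upwards [ae_restrict_mem measurableSet_Ioi] with u hu
    have hu0 : 0 < u := hu
    have := Real.rpow_nonneg hu0.le (t - 1)
    simp only [Pi.zero_apply]
    positivity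
  · have : Function.support (fun u : ℝ => u ^ (t - 1) / (1 + u)) ∩ Ioi 0 = Ioi 0 := by
      refine inter_eq_right.mpr fun u hu => ?_
      have hu0 : 0 < u := hu
      have := Real.rpow_pos_of_pos hu0 (t - 1)
      exact (by positivity : u ^ (t - 1) / (1 + u) ≠ 0)
    rw [this]
    simp

theorem integral_rpow_mul_div_add {t x : ℝ} (h0 : 0 < t) (h1 : t < 1) (hx : 0 < x) :
    IntegrableOn (fun u : ℝ => u ^ (t - 1) * (x / (x + u))) (Ioi 0) ∧
      ∫ u in Ioi (0 : ℝ), u ^ (t - 1) * (x / (x + u)) = x ^ t * stieltjesConst t := by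
  have hform : ∀ u ∈ Ioi (0 : ℝ), u ^ (t - 1) * (x / (x + u)) =
      x ^ (t - 1) * ((x⁻¹ * u) ^ (t - 1) / (1 + x⁻¹ * u)) := by
    intro u hu
    have hu0 : 0 < u := hu
    rw [Real.mul_rpow (by positivity) hu0.le, Real.inv_rpow hx.le]
    have := Real.rpow_pos_of_pos hx (t - 1)
    field_simp
  constructor
  · refine IntegrableOn.congr_fun ?_ (fun u hu => (hform u hu).symm) measurableSet_Ioi
    refine Integrable.const_mul ?_ _
    have := (integrableOn_Ioi_comp_mul_left_iff
      (fun u : ℝ => u ^ (t - 1) / (1 + u)) 0 (inv_pos.mpr hx)).mpr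
    simp only [mul_zero] at this
    exact this (integrableOn_rpow_div_one_add h0 h1)
  · rw [setIntegral_congr_fun measurableSet_Ioi hform, MeasureTheory.integral_const_mul,
      integral_comp_mul_left_Ioi (fun u : ℝ => u ^ (t - 1) / (1 + u)) 0 (inv_pos.mpr hx)]
    rw [mul_zero, inv_inv, smul_eq_mul, ← mul_assoc, ← Real.rpow_add_one hx.ne', sub_add_cancel]
    rfl

/-- Partial fractions in `u`, then the scaling `u ↦ x u`. Only the positivity of the constant is
needed later, not its value. -/
theorem stieltjes_representation {t x : ℝ} (h0 : 0 < t) (h1 : t < 1) (hx : 0 < x) (hx1 : x < 1) :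
    IntegrableOn (fun u : ℝ => stieltjesWeight t u / (x + u)) (Ioi 0) ∧
      ∫ u in Ioi (0 : ℝ), stieltjesWeight t u / (x + u) =
        stieltjesConst t * ((1 - x ^ t) / (1 - x)) := by
  have hform : ∀ u ∈ Ioi (0 : ℝ), stieltjesWeight t u / (x + u) =
      (1 - x)⁻¹ * (u ^ (t - 1) / (1 + u) - u ^ (t - 1) * (x / (x + u))) := by
    intro u hu
    have hu0 : 0 < u := hu
    have hne : 1 - x ≠ 0 := by linarith
    have : u ^ t = u ^ (t - 1) * u := by rw [← Real.rpow_add_one hu0.ne', sub_add_cancel]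
    unfold stieltjesWeight
    rw [this]
    field_simp
    ring
  obtain ⟨hi, he⟩ := integral_rpow_mul_div_add h0 h1 hx
  have hi' := integrableOn_rpow_div_one_add h0 h1
  constructor
  · exact IntegrableOn.congr_fun ((hi'.sub hi).const_mul _)
      (fun u hu => (hform u hu).symm) measurableSet_Ioi
  · rw [setIntegral_congr_fun measurableSet_Ioi hform, MeasureTheory.integral_const_mul,
      MeasureTheory.integral_sub hi' hi, he]
    unfold stieltjesConst
    have hne : 1 - x ≠ 0 := by linarith
    field_simp

theorem quot_mem_Icc {t x : ℝ} (h0 : 0 ≤ t) (h1 : t ≤ 1) (hx : 0 < x) (hx1 : x < 1) :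
    (1 - x ^ t) / (1 - x) ∈ Icc (0 : ℝ) 1 := by
  have h := Real.rpow_le_one hx.le hx1.le h0
  have h' : x ≤ x ^ t := by
    simpa using Real.rpow_le_rpow_of_exponent_ge hx hx1.le h1
  exact ⟨div_nonneg (by linarith) (by linarith), (div_le_one (by linarith)).mpr (by linarith)⟩

/-- The moments of `(1 - x ^ t) / (1 - x)`. -/
noncomputable def moment (t : ℝ) (K : ℕ) : ℝ :=
  ∫ x in Ioo (0 : ℝ) 1, x ^ K * ((1 - x ^ t) / (1 - x))

theorem integrableOn_moment {t : ℝ} (h0 : 0 ≤ t) (h1 : t ≤ 1) (K : ℕ) :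
    IntegrableOn (fun x : ℝ => x ^ K * ((1 - x ^ t) / (1 - x))) (Ioo 0 1) := by
  have : IntegrableOn (fun _ : ℝ => (1 : ℝ)) (Ioo 0 1) := by simp
  refine this.mono' (by fun_prop : Measurable _).aestronglyMeasurable ?_
  filter_upwards [ae_restrict_mem measurableSet_Ioo] with x hx
  have h := quot_mem_Icc h0 h1 hx.1 hx.2
  rw [Real.norm_of_nonneg (mul_nonneg (pow_nonneg hx.1.le _) h.1)]
  exact mul_le_one₀ (pow_le_one₀ hx.1.le hx.2.le) h.1 h.2

theorem moment_nonneg {t : ℝ} (h0 : 0 ≤ t) (h1 : t ≤ 1) (K : ℕ) : 0 ≤ moment t K :=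
  setIntegral_nonneg measurableSet_Ioo fun _ hx =>
    mul_nonneg (pow_nonneg hx.1.le _) (quot_mem_Icc h0 h1 hx.1 hx.2).1

theorem moment_le {t : ℝ} (h0 : 0 ≤ t) (h1 : t ≤ 1) (K : ℕ) : moment t K ≤ 1 / (K + 1) := by
  have h : ∫ x in Ioo (0 : ℝ) 1, x ^ K = 1 / (K + 1) := by
    rw [← integral_Ioc_eq_integral_Ioo, ← integral_of_le zero_le_one, integral_pow]
    simp
  rw [← h]
  refine setIntegral_mono_on (integrableOn_moment h0 h1 K) ?_ measurableSet_Ioo fun x hx => ?_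
  · exact (Continuous.integrableOn_Icc (by fun_prop)).mono_set Ioo_subset_Icc_self
  · exact mul_le_of_le_one_right (pow_nonneg hx.1.le _) (quot_mem_Icc h0 h1 hx.1 hx.2).2

theorem moment_sub_moment_succ {t : ℝ} (h0 : 0 ≤ t) (h1 : t ≤ 1) (K : ℕ) :
    moment t K - moment t (K + 1) = 1 / (K + 1) - 1 / (K + 1 + t) := by
  unfold moment
  rw [← MeasureTheory.integral_sub (integrableOn_moment h0 h1 K)
    (integrableOn_moment h0 h1 (K + 1))]
  have hform : ∀ x ∈ Ioo (0 : ℝ) 1, x ^ K * ((1 - x ^ t) / (1 - x)) -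
      x ^ (K + 1) * ((1 - x ^ t) / (1 - x)) = x ^ (K : ℝ) - x ^ ((K : ℝ) + t) := by
    intro x hx
    have hne : 1 - x ≠ 0 := by linarith [hx.2]
    rw [Real.rpow_add hx.1, Real.rpow_natCast]
    field_simp
    ring
  have hK : (-1 : ℝ) < K := by linarith [(Nat.cast_nonneg K : (0 : ℝ) ≤ K)]
  rw [setIntegral_congr_fun measurableSet_Ioo hform, ← integral_Ioc_eq_integral_Ioo,
    ← integral_of_le zero_le_one, intervalIntegral.integral_sub
      (intervalIntegrable_rpow' hK) (intervalIntegrable_rpow' (by linarith)),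
    integral_rpow (Or.inl hK), integral_rpow (Or.inl (by linarith))]
  rw [Real.one_rpow, Real.one_rpow, Real.zero_rpow (by linarith), Real.zero_rpow (by linarith)]
  rw [sub_zero, add_right_comm]

theorem intervalIntegrable_moment (K : ℕ) :
    IntervalIntegrable (fun t => moment t K) volume 0 1 := by
  refine MonotoneOn.intervalIntegrable ?_
  rw [uIcc_of_le zero_le_one]
  intro s hs t ht hst
  refine setIntegral_mono_on (integrableOn_moment hs.1 hs.2 K) (integrableOn_moment ht.1 ht.2 K)
    measurableSet_Ioo fun x hx => ?_
  have := Real.rpow_le_rpow_of_exponent_ge hx.1 hx.2.le hst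
  have h1 : 0 < 1 - x := by linarith [hx.2]
  have := pow_nonneg hx.1.le K
  gcongr

theorem integral_moment_succ (K : ℕ) :
    (∫ t in (0 : ℝ)..1, moment t K) - ∫ t in (0 : ℝ)..1, moment t (K + 1) =
      Real.eulerMascheroniSeq (K + 1) - Real.eulerMascheroniSeq K := by
  rw [← integral_sub (intervalIntegrable_moment K) (intervalIntegrable_moment (K + 1))]
  have hK : (0 : ℝ) < K + 1 := by positivity
  have h1 : ∫ t in (0 : ℝ)..1, (moment t K - moment t (K + 1)) =
      ∫ t in (0 : ℝ)..1, (1 / ((K : ℝ) + 1) - 1 / (K + 1 + t)) := by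
    refine integral_congr fun t ht => ?_
    rw [uIcc_of_le zero_le_one] at ht
    exact moment_sub_moment_succ ht.1 ht.2 K
  have hint : IntervalIntegrable (fun t : ℝ => 1 / ((K : ℝ) + 1 + t)) volume 0 1 := by
    refine ContinuousOn.intervalIntegrable ?_
    rw [uIcc_of_le zero_le_one]
    refine ContinuousOn.div (by fun_prop) (by fun_prop) fun t ht => ?_
    linarith [ht.1]
  rw [h1, integral_sub (by simp) hint,
    integral_comp_add_left (fun t : ℝ => 1 / t) ((K : ℝ) + 1),
    integral_one_div_of_pos (by linarith) (by linarith),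
    Real.log_div (by positivity) (by positivity)]
  simp only [Real.eulerMascheroniSeq, harmonic_succ]
  push_cast
  rw [add_zero, intervalIntegral.integral_const]
  simp
  ring

theorem tendsto_integral_moment :
    Filter.Tendsto (fun K : ℕ => ∫ t in (0 : ℝ)..1, moment t K) Filter.atTop (nhds 0) := by
  refine squeeze_zero (fun K => integral_nonneg zero_le_one fun t ht =>
    moment_nonneg ht.1 ht.2 K) (fun K => ?_) tendsto_one_div_add_atTop_nhds_zero_nat
  calc ∫ t in (0 : ℝ)..1, moment t K ≤ ∫ t in (0 : ℝ)..1, (1 / ((K : ℝ) + 1)) :=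
        integral_mono_on zero_le_one (intervalIntegrable_moment K) (by simp)
          fun t ht => moment_le ht.1 ht.2 K
    _ = 1 / ((K : ℝ) + 1) := by simp

/-- Both sides have the same increments in `K` and tend to zero. -/
theorem eulerMascheroniConstant_sub_seq (K : ℕ) :
    Real.eulerMascheroniConstant - Real.eulerMascheroniSeq K = ∫ t in (0 : ℝ)..1, moment t K := by
  have hconst : ∀ K, Real.eulerMascheroniSeq K + ∫ t in (0 : ℝ)..1, moment t K =
      Real.eulerMascheroniSeq 0 + ∫ t in (0 : ℝ)..1, moment t 0 := by
    intro K
    induction K with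
    | zero => rfl
    | succ K ih => linarith [integral_moment_succ K]
  have hlim := Real.tendsto_eulerMascheroniSeq.add tendsto_integral_moment
  simp only [hconst] at hlim
  have := tendsto_nhds_unique hlim tendsto_const_nhds
  linarith [hconst K]

/-- The integral of `x ^ K / (x + u)` over the unit interval. -/
noncomputable def cauchyMoment (u : ℝ) (K : ℕ) : ℝ := ∫ x in (0 : ℝ)..1, x ^ K / (x + u)

theorem integrableOn_prod_kernel {t : ℝ} (h0 : 0 < t) (h1 : t < 1) (K : ℕ) :
    Integrable (Function.uncurry fun x u : ℝ => stieltjesWeight t u * (x ^ K / (x + u)))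
      ((volume.restrict (Ioo 0 1)).prod (volume.restrict (Ioi 0))) := by
  have hform : ∀ x u : ℝ, stieltjesWeight t u * (x ^ K / (x + u)) =
      x ^ K * (stieltjesWeight t u / (x + u)) := fun x u => by ring
  rw [integrable_prod_iff]
  · constructor
    · filter_upwards [ae_restrict_mem measurableSet_Ioo] with x hx
      simp only [Function.uncurry, hform]
      exact (stieltjes_representation h0 h1 hx.1 hx.2).1.const_mul _
    · refine ((integrableOn_moment h0.le h1.le K).const_mul (stieltjesConst t)).congr ?_
      filter_upwards [ae_restrict_mem measurableSet_Ioo] with x hx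
      have : ∀ u ∈ Ioi (0 : ℝ), ‖stieltjesWeight t u * (x ^ K / (x + u))‖ =
          x ^ K * (stieltjesWeight t u / (x + u)) := by
        intro u hu
        have hu0 : 0 < u := hu
        have hx0 := hx.1
        have := Real.rpow_nonneg hu0.le t
        rw [Real.norm_of_nonneg, hform]
        unfold stieltjesWeight
        positivity
      simp only [Function.uncurry]
      rw [setIntegral_congr_fun measurableSet_Ioi this, MeasureTheory.integral_const_mul,
        (stieltjes_representation h0 h1 hx.1 hx.2).2]
      ring
  · refine Measurable.aestronglyMeasurable ?_
    unfold stieltjesWeight Function.uncurry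
    fun_prop

theorem cauchyMoment_eq (u : ℝ) (K : ℕ) :
    cauchyMoment u K = ∫ x in Ioo (0 : ℝ) 1, x ^ K / (x + u) := by
  rw [cauchyMoment, integral_of_le zero_le_one, integral_Ioc_eq_integral_Ioo]

theorem integrableOn_weight_mul_cauchyMoment {t : ℝ} (h0 : 0 < t) (h1 : t < 1) (K : ℕ) :
    IntegrableOn (fun u => stieltjesWeight t u * cauchyMoment u K) (Ioi 0) := by
  refine (integrableOn_prod_kernel h0 h1 K).integral_prod_right.congr (ae_of_all _ fun u => ?_)
  simp only [Function.uncurry]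
  rw [MeasureTheory.integral_const_mul, cauchyMoment_eq]

theorem integral_weight_mul_cauchyMoment {t : ℝ} (h0 : 0 < t) (h1 : t < 1) (K : ℕ) :
    ∫ u in Ioi (0 : ℝ), stieltjesWeight t u * cauchyMoment u K =
      stieltjesConst t * moment t K := by
  have h := integral_integral_swap (integrableOn_prod_kernel h0 h1 K)
  calc ∫ u in Ioi (0 : ℝ), stieltjesWeight t u * cauchyMoment u K
      = ∫ u in Ioi (0 : ℝ), ∫ x in Ioo (0 : ℝ) 1, stieltjesWeight t u * (x ^ K / (x + u)) := by
        simp only [MeasureTheory.integral_const_mul, cauchyMoment_eq]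
    _ = ∫ x in Ioo (0 : ℝ) 1, ∫ u in Ioi (0 : ℝ), stieltjesWeight t u * (x ^ K / (x + u)) :=
        h.symm
    _ = ∫ x in Ioo (0 : ℝ) 1, stieltjesConst t * (x ^ K * ((1 - x ^ t) / (1 - x))) := by
        refine setIntegral_congr_fun measurableSet_Ioo fun x hx => ?_
        have hform : ∀ u : ℝ, stieltjesWeight t u * (x ^ K / (x + u)) =
          x ^ K * (stieltjesWeight t u / (x + u)) := fun u => by ring
        simp only [hform]
        rw [MeasureTheory.integral_const_mul, (stieltjes_representation h0 h1 hx.1 hx.2).2]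
        ring
    _ = stieltjesConst t * moment t K := MeasureTheory.integral_const_mul _ _

/-- A linear inequality between the sequences `∫ x ^ K / (x + u)`, uniform in `u > 0`, is
inherited by `γ - S_K`. -/
theorem abs_sum_gamma_le {ι : Type*} (s : Finset ι) (w : ι → ℝ) (K : ι → ℕ) (m : ℕ) (B : ℝ)
    (h : ∀ u : ℝ, 0 < u → |∑ k ∈ s, w k * cauchyMoment u (K k)| ≤ B * cauchyMoment u m) :
    |∑ k ∈ s, w k * (Real.eulerMascheroniConstant - Real.eulerMascheroniSeq (K k))| ≤
      B * (Real.eulerMascheroniConstant - Real.eulerMascheroniSeq m) := by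
  have step : ∀ t ∈ Ioo (0 : ℝ) 1, |∑ k ∈ s, w k * moment t (K k)| ≤ B * moment t m := by
    rintro t ⟨h0, h1⟩
    have hc := stieltjesConst_pos h0 h1
    have hsum : stieltjesConst t * ∑ k ∈ s, w k * moment t (K k) =
        ∫ u in Ioi (0 : ℝ), stieltjesWeight t u * ∑ k ∈ s, w k * cauchyMoment u (K k) := by
      simp only [Finset.mul_sum, mul_left_comm _ (w _)]
      rw [MeasureTheory.integral_finsetSum]
      · refine Finset.sum_congr rfl fun k _ => ?_
        rw [MeasureTheory.integral_const_mul, integral_weight_mul_cauchyMoment h0 h1]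
      · exact fun k _ => (integrableOn_weight_mul_cauchyMoment h0 h1 (K k)).const_mul _
    have hbound : ∫ u in Ioi (0 : ℝ), B * (stieltjesWeight t u * cauchyMoment u m) =
        B * (stieltjesConst t * moment t m) := by
      rw [MeasureTheory.integral_const_mul, integral_weight_mul_cauchyMoment h0 h1]
    refine le_of_mul_le_mul_left ?_ hc
    rw [← abs_of_pos hc, ← abs_mul, abs_of_pos hc, hsum, mul_left_comm, ← hbound,
      ← Real.norm_eq_abs]
    refine norm_integral_le_of_norm_le
      ((integrableOn_weight_mul_cauchyMoment h0 h1 m).const_mul B) ?_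
    filter_upwards [ae_restrict_mem measurableSet_Ioi] with u hu
    have hu0 : 0 < u := hu
    have hw : 0 ≤ stieltjesWeight t u := by
      have := Real.rpow_nonneg hu0.le t
      unfold stieltjesWeight
      positivity
    rw [Real.norm_eq_abs, abs_mul, abs_of_nonneg hw, mul_left_comm]
    exact mul_le_mul_of_nonneg_left (h u hu0) hw
  simp only [eulerMascheroniConstant_sub_seq]
  have hsum : ∑ k ∈ s, w k * ∫ t in (0 : ℝ)..1, moment t (K k) =
      ∫ t in Ioo (0 : ℝ) 1, ∑ k ∈ s, w k * moment t (K k) := by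
    rw [← integral_Ioc_eq_integral_Ioo, ← integral_of_le zero_le_one,
      intervalIntegral.integral_finsetSum]
    · simp only [intervalIntegral.integral_const_mul]
    · exact fun k _ => (intervalIntegrable_moment (K k)).const_mul _
  have hbound : B * ∫ t in (0 : ℝ)..1, moment t m = ∫ t in Ioo (0 : ℝ) 1, B * moment t m := by
    rw [MeasureTheory.integral_const_mul, ← integral_Ioc_eq_integral_Ioo,
      ← integral_of_le zero_le_one]
  rw [hsum, hbound, ← Real.norm_eq_abs]
  refine norm_integral_le_of_norm_le ?_ ?_
  · exact (((intervalIntegrable_iff_integrableOn_Ioc_of_le zero_le_one).mp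
      (intervalIntegrable_moment m)).mono_set Ioo_subset_Ioc_self).const_mul B
  · filter_upwards [ae_restrict_mem measurableSet_Ioo] with t ht
    exact step t ht

end EulerGamma

namespace EulerGamma

open intervalIntegral

/-! ### Pointwise maximisation and the geometric rate. -/

theorem rpow_mul_rpow_le {α β X Y : ℝ} (hα : 0 ≤ α) (hβ : 0 ≤ β) (hX : 0 ≤ X) (hY : 0 ≤ Y)
    (hXY : X + Y = 1) (hs : 0 < α + β) :
    X ^ α * Y ^ β ≤ α ^ α * β ^ β / (α + β) ^ (α + β) := by
  rcases hα.eq_or_lt with rfl | hα'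
  · have hne : β ^ β ≠ 0 := by
      have : 0 < β := by linarith
      positivity
    simpa [hne] using Real.rpow_le_one hY (by linarith) hβ
  rcases hβ.eq_or_lt with rfl | hβ'
  · have hne : α ^ α ≠ 0 := by positivity
    simpa [hne] using Real.rpow_le_one hX (by linarith) hα
  have hw1 : 0 < α / (α + β) := by positivity
  have hw2 : 0 < β / (α + β) := by positivity
  -- Weighted AM-GM for `X/w₁` and `Y/w₂`, whose weighted mean is `X + Y = 1`; the weights must be
  -- nonzero, hence the separate degenerate cases.
  have h := Real.geom_mean_le_arith_mean2_weighted hw1.le hw2.le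
    (div_nonneg hX hw1.le) (div_nonneg hY hw2.le) (by field_simp)
  rw [mul_div_cancel₀ _ hw1.ne', mul_div_cancel₀ _ hw2.ne', hXY] at h
  have h' := Real.rpow_le_one (by positivity) h hs.le
  rw [Real.mul_rpow (by positivity) (by positivity), ← Real.rpow_mul (by positivity),
    ← Real.rpow_mul (by positivity), div_mul_cancel₀ _ hs.ne', div_mul_cancel₀ _ hs.ne',
    Real.div_rpow hX hw1.le, Real.div_rpow hY hw2.le, div_mul_div_comm,
    div_le_one (by positivity)] at h'
  refine h'.trans_eq ?_
  rw [Real.div_rpow hα hs.le, Real.div_rpow hβ hs.le, Real.rpow_add hs, div_mul_div_comm]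

/-- The previous bound with `X = x^r` and exponents `b/r`, `C`. The factor `r^C` later cancels the
normalisation `(-r)^(C n)`. -/
theorem pow_mul_one_sub_pow_le {r b C : ℕ} (hr : 0 < r) (hb : 0 < b) {x : ℝ}
    (hx : 0 ≤ x) (hx1 : x ≤ 1) :
    x ^ b * (1 - x ^ r) ^ C ≤ (r : ℝ) ^ C * ((b : ℝ) ^ ((b : ℝ) / r) * (C : ℝ) ^ (C : ℝ) /
      ((b : ℝ) + C * r) ^ ((C : ℝ) + (b : ℝ) / r)) := by
  have hr' : (0 : ℝ) < r := by exact_mod_cast hr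
  have hb' : (0 : ℝ) < b := by exact_mod_cast hb
  have h := rpow_mul_rpow_le (α := (b : ℝ) / r) (β := C) (X := x ^ r) (Y := 1 - x ^ r)
    (by positivity) (by positivity) (by positivity) (sub_nonneg.mpr (pow_le_one₀ hx hx1))
    (by ring) (by positivity)
  have h1 : (x ^ r : ℝ) ^ ((b : ℝ) / r) = x ^ b := by
    rw [← Real.rpow_natCast x r, ← Real.rpow_mul hx, mul_div_cancel₀ _ hr'.ne', Real.rpow_natCast]
  rw [h1, Real.rpow_natCast] at h
  refine h.trans_eq ?_
  have h2 : (b : ℝ) / r + C = ((b : ℝ) + C * r) / r := by field_simp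
  have hp : 0 < (r : ℝ) ^ ((b : ℝ) / r) := by positivity
  rw [add_comm ((C : ℝ)) ((b : ℝ) / r)]
  nth_rw 1 [h2]
  rw [Real.div_rpow hb'.le hr'.le, Real.div_rpow (by positivity) hr'.le, Real.rpow_add hr',
    Real.rpow_natCast (r : ℝ) C]
  field_simp

theorem pow_mul_pow_le {p e : ℕ} (h : 0 < p + e) {x u : ℝ} (hx : 0 ≤ x) (hu : 0 < u) :
    (u / (x + u)) ^ p * (x / (x + u)) ^ e ≤
      (p : ℝ) ^ (p : ℝ) * (e : ℝ) ^ (e : ℝ) / ((p + e : ℕ) : ℝ) ^ ((p + e : ℕ) : ℝ) := by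
  have h' : (0 : ℝ) < p + e := by exact_mod_cast h
  have hxu : x + u ≠ 0 := by positivity
  have := rpow_mul_rpow_le (α := p) (β := e) (X := u / (x + u)) (Y := x / (x + u))
    (by positivity) (by positivity) (by positivity) (by positivity) (by field_simp; ring) h'
  rw [Real.rpow_natCast, Real.rpow_natCast] at this
  push_cast
  exact this

/-- The base of the rate in terms of `p = d + b - a - C` and `e = C + a - b`. -/
theorem rateBase_eq {C r b a p e : ℕ} (h : b + e = C + a) :
    rateBase C ((p + e : ℕ) : ℝ) r b a =
      ((p : ℝ) ^ (p : ℝ) * (e : ℝ) ^ (e : ℝ) / ((p + e : ℕ) : ℝ) ^ ((p + e : ℕ) : ℝ)) *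
      ((b : ℝ) ^ ((b : ℝ) / r) * (C : ℝ) ^ (C : ℝ) /
        ((b : ℝ) + C * r) ^ ((C : ℝ) + (b : ℝ) / r)) := by
  have h' : (b : ℝ) + e = C + a := by exact_mod_cast h
  have h1 : (C : ℝ) + a - b = e := by linarith
  have h2 : ((p + e : ℕ) : ℝ) + b - a - C = p := by push_cast; linarith
  rw [rateBase, h1, h2, div_mul_div_comm]
  ring

theorem pow_mul_pairing_nil_le {C r b n a p e m : ℕ} (hr : 0 < r) (hb : 0 < b) (hd : 0 < p + e)
    (h : b + e = C + a) {u : ℝ} (hu : 0 < u) :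
    u ^ (p * n) * pairing r (C * n) u [] (b * n + m + e * n) (p * n + e * n + 1) ≤
      (r : ℝ) ^ (C * n) * rateBase C ((p + e : ℕ) : ℝ) r b a ^ n * cauchyMoment u m := by
  unfold pairing cauchyMoment
  rw [← integral_const_mul, ← integral_const_mul]
  refine integral_mono_on zero_le_one ?_ ?_ fun x hx => ?_
  · exact (intervalIntegrable_kern_mul hu _ _ (continuous_altSum _ _ _)).const_mul _
  · have := intervalIntegrable_kern_mul hu m 1 (f := fun _ => 1) continuous_const
    simp only [kern, pow_one, mul_one] at this
    exact this.const_mul _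
  · have hx0 := hx.1
    have hxu : x + u ≠ 0 := by positivity
    have h1 : 0 ≤ 1 - x ^ r := sub_nonneg.mpr (pow_le_one₀ hx.1 hx.2)
    have i1 := pow_mul_pow_le hd hx0 hu
    have i2 := pow_mul_one_sub_pow_le (C := C) hr hb hx.1 hx.2
    have i3 := (mul_le_mul i1 i2 (by positivity) (by positivity)).trans_eq
      (mul_left_comm _ _ _)
    rw [← rateBase_eq h] at i3
    have i4 := pow_le_pow_left₀ (by positivity) i3 n
    rw [altSum_nil]
    calc u ^ (p * n) * (kern u (b * n + m + e * n) (p * n + e * n + 1) x * (1 - x ^ r) ^ (C * n))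
        = ((u / (x + u)) ^ p * (x / (x + u)) ^ e * (x ^ b * (1 - x ^ r) ^ C)) ^ n *
          (x ^ m / (x + u)) := by
          unfold kern
          simp only [mul_pow, div_pow, ← pow_mul, pow_add, pow_one]
          field_simp
      _ ≤ ((r : ℝ) ^ C * rateBase C ((p + e : ℕ) : ℝ) r b a) ^ n * (x ^ m / (x + u)) := by gcongr
      _ = _ := by rw [mul_pow, ← pow_mul]

theorem abs_sum_cauchyMoment_le {c : ℕ → ℕ} {M r b n a p e : ℕ} (hr : 0 < r) (hb : 0 < b)
    (hd : 0 < c M) (hpe : p + e = c M) (h : b + e = ∑ j ∈ Finset.range (M + 1), c j + a) {u : ℝ}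
    (hu : 0 < u) :
    |∑ k ∈ Finset.range ((∑ j ∈ Finset.range (M + 1), c j) * n + 1), (-1 : ℝ) ^ k *
        (((∑ j ∈ Finset.range (M + 1), c j) * n).choose k : ℝ) *
        (shiftProd (fullList (b * n + (M + 1)) (p * n) (e * n) (blocks a c n M)) (r * k) : ℝ) *
        cauchyMoment u (r * k + b * n + (M + 1))| ≤
      ((∑ j ∈ Finset.range (M + 1), c j : ℕ) : ℝ) ^ M *
        (((∑ j ∈ Finset.range (M + 1), c j) * n).factorial : ℝ) *
        (r : ℝ) ^ ((∑ j ∈ Finset.range (M + 1), c j) * n) *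
        rateBase (∑ j ∈ Finset.range (M + 1), c j : ℕ) (c M) r b a ^ n *
        cauchyMoment u (M + 1) := by
  have hC : ∑ j ∈ Finset.range (M + 1), c j = ∑ j ∈ Finset.range M, c j + c M :=
    Finset.sum_range_succ _ _
  set S := ∑ j ∈ Finset.range M, c j with hS
  set C := ∑ j ∈ Finset.range (M + 1), c j with hCdef
  have hpen : p * n + e * n = c M * n := by rw [← add_mul, hpe]
  have hqe : b * n + (M + 1) + e * n = (a + S + c M) * n + M + 0 + 1 := by
    have : b * n + e * n = (a + S + c M) * n := by rw [← add_mul, h, hC]; ring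
    omega
  have hbp : p ≤ b := by omega
  have hlen : p * n + e * n + (blocks a c n M).length ≤ C * n := by
    rw [hpen, length_blocks, ← hS, hC]
    exact le_of_eq (by ring)
  have hadm : Admissible (b * n + (M + 1) + e * n) (p * n + e * n + 1) (blocks a c n M) := by
    refine admissible_blocks _ _ _ _ _ _ ?_
    rw [hqe, hpen, ← hS]
    have : (a + S + c M) * n = (a + S) * n + c M * n := by ring
    omega
  have hpq : p * n ≤ b * n + (M + 1) := (Nat.mul_le_mul_right n hbp).trans (Nat.le_add_right _ _)
  have h1 := abs_pairing_fullList_le hr hu hlen hpq hadm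
  have h2 := mul_prod_blocks_le a c n M (c M) 0 (c M * n).factorial hd (by simp)
  rw [← hS, add_comm (c M) S, ← hC, ← hqe, zero_add] at h2
  have h3 := pow_mul_pairing_nil_le (n := n) (m := M + 1) hr hb (hpe ▸ hd : 0 < p + e) h hu
  rw [hpe] at h3
  rw [pairing_eq_sum hu] at h1
  have h4 : ((((p * n + e * n).factorial * ((blocks a c n M).map fun κ =>
      b * n + (M + 1) + e * n - κ).prod : ℕ)) : ℝ) ≤ ((C * n).factorial * C ^ M : ℕ) := by
    rw [hpen]
    exact_mod_cast h2
  have h5 := pairing_nil_nonneg r (C * n) hu (b * n + (M + 1) + e * n) (p * n + e * n + 1)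
  simp only [← add_assoc, cauchyMoment] at h1 h3 h4 h5 ⊢
  refine h1.trans ?_
  calc _ ≤ u ^ (p * n) * ((C * n).factorial * C ^ M : ℕ) *
        pairing r (C * n) u [] (b * n + M + 1 + e * n) (p * n + e * n + 1) := by
        gcongr
    _ = ((C * n).factorial * C ^ M : ℕ) * (u ^ (p * n) *
        pairing r (C * n) u [] (b * n + M + 1 + e * n) (p * n + e * n + 1)) := by ring
    _ ≤ _ := mul_le_mul_of_nonneg_left h3 (Nat.cast_nonneg _)
    _ = _ := by push_cast; ring

end EulerGamma

namespace EulerGamma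

/-! ### Identification with the linear form, and conclusion. -/

theorem sum_Iic_eq_sum_range {m : ℕ} (c : ℕ → ℕ) (j : Fin m) :
    ∑ i ∈ Finset.Iic j, c i = ∑ i ∈ Finset.range ((j : ℕ) + 1), c i := by
  have h : (Finset.Iic j).map Fin.valEmbedding = Finset.range ((j : ℕ) + 1) := by
    rw [Fin.map_valEmbedding_Iic]
    ext i
    simp
  rw [← h, Finset.sum_map]
  rfl

/-- The product of binomial coefficients in terms of `shiftProd`. -/
theorem prod_factorial_mul_prod_choose (c : ℕ → ℕ) {M a n q p e : ℕ} (hp : p ≤ q)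
    (hpe : p + e = c M * n)
    (hq : q + e = (a + ∑ i ∈ Finset.range (M + 1), c i) * n + (M + 1)) (k : ℕ) :
    (∏ j : Fin (M + 1), (c j * n).factorial) * ∏ j : Fin (M + 1),
      (k + (a + ∑ i ∈ Finset.range ((j : ℕ) + 1), c i) * n + ((j : ℕ) + 1)).choose (c j * n) =
      shiftProd (fullList q p e (blocks a c n M)) k := by
  rw [← Finset.prod_mul_distrib]
  simp only [← Nat.descFactorial_eq_factorial_mul_choose]
  rw [Fin.prod_univ_eq_prod_range (fun j => (k + (a + ∑ i ∈ Finset.range (j + 1), c i) * n +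
    (j + 1)).descFactorial (c j * n)) (M + 1), Finset.prod_range_succ, ← shiftProd_blocks,
    shiftProd_fullList e _ hp, hpe, mul_comm, add_assoc k q e, hq, add_assoc k]

theorem abs_gamma_sub_linearForm_le {c : ℕ → ℕ} {M r b n a p e : ℕ} (hr : 0 < r) (hb : 0 < b)
    (hd : 0 < c M) (hpe : p + e = c M) (h : b + e = ∑ j ∈ Finset.range (M + 1), c j + a) :
    |Real.eulerMascheroniConstant - linearForm (fun j : Fin (M + 1) => c j) r b n a| ≤
      ((∑ j ∈ Finset.range (M + 1), c j : ℕ) : ℝ) ^ M *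
        rateBase (∑ j ∈ Finset.range (M + 1), c j : ℕ) (c M) r b a ^ n *
        (Real.eulerMascheroniConstant - Real.eulerMascheroniSeq (M + 1)) := by
  have htot : total (fun j : Fin (M + 1) => c j) = ∑ j ∈ Finset.range (M + 1), c j :=
    Fin.sum_univ_eq_sum_range c (M + 1)
  have hpart : ∀ j : Fin (M + 1), partialTotal (fun j : Fin (M + 1) => c j) j =
      ∑ i ∈ Finset.range ((j : ℕ) + 1), c i := sum_Iic_eq_sum_range c
  have hu := abs_sum_gamma_le _ _ _ _ _
    (fun u hu => abs_sum_cauchyMoment_le (n := n) (a := a) hr hb hd hpe h (u := u) hu)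
  have hpen : p * n + e * n = c M * n := by rw [← add_mul, hpe]
  have hbp : p ≤ b := by
    rw [Finset.sum_range_succ] at h
    omega
  have hpq : p * n ≤ b * n + (M + 1) := (Nat.mul_le_mul_right n hbp).trans (Nat.le_add_right _ _)
  have hq : b * n + (M + 1) + e * n =
      (a + ∑ i ∈ Finset.range (M + 1), c i) * n + (M + 1) := by
    have : b * n + e * n = (a + ∑ i ∈ Finset.range (M + 1), c i) * n := by
      rw [← add_mul, h]; ring
    omega
  have hlen : (fullList (b * n + (M + 1)) (p * n) (e * n) (blocks a c n M)).length =
      (∑ j ∈ Finset.range (M + 1), c j) * n := by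
    rw [length_fullList, length_blocks, hpen, Finset.sum_range_succ]
    ring
  have hone := alternating_sum_shiftProd hr hlen
  have hchoose := prod_factorial_mul_prod_choose c hpq hpen hq
  unfold linearForm
  rw [htot]
  simp only [hpart]
  generalize ∑ j ∈ Finset.range (M + 1), c j = C at *
  generalize fullList (b * n + (M + 1)) (p * n) (e * n) (blocks a c n M) = l at *
  set D : ℝ := ((C * n).factorial : ℝ) * (-(r : ℝ)) ^ (C * n) with hD
  have hr' : (r : ℝ) ≠ 0 := by positivity
  have hD0 : D ≠ 0 := mul_ne_zero (by positivity) (pow_ne_zero _ (neg_ne_zero.mpr hr'))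
  have hDabs : |D| = ((C * n).factorial : ℝ) * (r : ℝ) ^ (C * n) := by
    rw [hD, abs_mul, abs_pow, abs_neg, Nat.abs_cast, Nat.abs_cast]
  have hDpos : 0 < |D| := abs_pos.mpr hD0
  have key : D * (Real.eulerMascheroniConstant - (∏ j : Fin (M + 1), ((c j * n).factorial : ℝ)) / D *
      ∑ k ∈ Finset.range (C * n + 1), (-1 : ℝ) ^ k * ((C * n).choose k : ℝ) *
        (∏ j : Fin (M + 1), ((r * k + (a + ∑ i ∈ Finset.range ((j : ℕ) + 1), c i) * n +
          ((j : ℕ) + 1)).choose (c j * n) : ℝ)) *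
        Real.eulerMascheroniSeq (r * k + b * n + (M + 1))) =
      ∑ k ∈ Finset.range (C * n + 1), (-1 : ℝ) ^ k * ((C * n).choose k : ℝ) *
        (shiftProd l (r * k) : ℝ) * (Real.eulerMascheroniConstant -
          Real.eulerMascheroniSeq (r * k + b * n + (M + 1))) := by
    simp only [mul_sub (_ * _ * _), Finset.sum_sub_distrib]
    rw [← Finset.sum_mul, hone, mul_sub, ← mul_assoc D, mul_div_cancel₀ _ hD0, Finset.mul_sum]
    congr 1
    · rw [hD]; ring
    · refine Finset.sum_congr rfl fun k _ => ?_
      rw [← hchoose (r * k)]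
      push_cast
      ring
  refine le_of_mul_le_mul_left ?_ hDpos
  rw [← abs_mul, key, hDabs]
  refine hu.trans_eq ?_
  ring

theorem rateBase_pos {C r b a p e : ℕ} (hC : 0 < C) (hr : 0 < r) (hb : 0 < b) (hd : 0 < p + e)
    (h : b + e = C + a) : 0 < rateBase C ((p + e : ℕ) : ℝ) r b a := by
  have hself : ∀ k : ℕ, (0 : ℝ) < (k : ℝ) ^ (k : ℝ) := by
    intro k
    rcases Nat.eq_zero_or_pos k with rfl | hk
    · simp
    · positivity
  rw [rateBase_eq h]
  have := hself p
  have := hself e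
  have := hself (p + e)
  have := hself C
  positivity

end EulerGamma

theorem theorem5 (m : ℕ) (hm : 0 < m) (c : Fin m → ℕ) (hc : ∀ j, 0 < c j) :
    ∃ M : ℝ, M < (total c : ℝ) ^ (m - 1) ∧
      ∀ r b n a : ℕ, 0 < r → 0 < b → 0 < n →
        (a : ℤ) - (lastEntry hm c : ℤ) ≤ (b : ℤ) - (total c : ℤ) →
        (b : ℤ) - (total c : ℤ) ≤ (a : ℤ) →
        |Real.eulerMascheroniConstant - linearForm c r b n a| <
          M * rateBase (total c) (lastEntry hm c) r b a ^ n := by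
  obtain ⟨N, rfl⟩ : ∃ N, m = N + 1 := ⟨m - 1, by omega⟩
  obtain ⟨c', rfl⟩ : ∃ c' : ℕ → ℕ, c = fun j : Fin (N + 1) => c' j :=
    ⟨fun j => if h : j < N + 1 then c ⟨j, h⟩ else 0, by funext j; simp only [j.isLt, dite_true]⟩
  have htot : total (fun j : Fin (N + 1) => c' j) = ∑ j ∈ Finset.range (N + 1), c' j :=
    Fin.sum_univ_eq_sum_range c' (N + 1)
  have hlast : lastEntry hm (fun j : Fin (N + 1) => c' j) = c' N := rfl
  have hd : 0 < c' N := hc ⟨N, by omega⟩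
  have hle : c' N ≤ ∑ j ∈ Finset.range (N + 1), c' j := by
    rw [Finset.sum_range_succ]
    omega
  rw [htot, hlast, Nat.add_sub_cancel]
  have hCpos : (0 : ℝ) < ((∑ j ∈ Finset.range (N + 1), c' j : ℕ) : ℝ) ^ N := by
    have : 0 < ∑ j ∈ Finset.range (N + 1), c' j := hd.trans_le hle
    positivity
  -- The factor `2/3` bounds `γ`, hence also `γ - S_m`, since `S_m ≥ S_0 = 0`.
  refine ⟨((∑ j ∈ Finset.range (N + 1), c' j : ℕ) : ℝ) ^ N * (2 / 3), by linarith, ?_⟩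
  intro r b n a hr hb _ h1 h2
  -- The two hypotheses on `a` and `b` say exactly that `0 ≤ e ≤ c_m`, which makes the splitting
  -- `c_m = p + e` possible.
  obtain ⟨e, he⟩ : ∃ e, b + e = ∑ j ∈ Finset.range (N + 1), c' j + a :=
    ⟨∑ j ∈ Finset.range (N + 1), c' j + a - b, by omega⟩
  obtain ⟨p, hp⟩ : ∃ p, p + e = c' N := ⟨c' N - e, by omega⟩
  refine (EulerGamma.abs_gamma_sub_linearForm_le hr hb hd hp he).trans_lt ?_
  have hrate := EulerGamma.rateBase_pos (hd.trans_le hle) hr hb (hp ▸ hd : 0 < p + e) he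
  rw [hp] at hrate
  have hS : 0 ≤ Real.eulerMascheroniSeq (N + 1) := by
    have := Real.strictMono_eulerMascheroniSeq.monotone (Nat.zero_le (N + 1))
    simpa [Real.eulerMascheroniSeq] using this
  have hgamma : Real.eulerMascheroniConstant - Real.eulerMascheroniSeq (N + 1) < 2 / 3 := by
    linarith [Real.eulerMascheroniConstant_lt_two_thirds]
  rw [mul_right_comm]
  gcongr
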